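/- Let $n\ge 1$ be an integer, let $k\ge 2$ be an even integer, and let $|\cdot|$ be the Euclidean norm on $\mathbb R^n$. For $t>0$ and $x_{1,n},\xi_{1,n}\in\mathbb R^n$ put $$Y_t=\int_0^t\Big|\tfrac{t-u}{t}\,x_{1,n}+\tfrac ut\,\xi_{1,n}+W^{0,t}_u\Big|^k\,du ,$$ where $(W^{0,t}_u)_{u\in[0,t]}$ is a standard $n$-dimensional Brownian bridge on $[0,t]$ from $0$ to $0$, i.e. a continuous centred Gaussian process with independent coordinates, each with covariance $(s,u)\mapsto s\wedge u-su/t$. (a) There are constants $c_1,c_2>0$ depending only on $(n,k)$ such that for all $x_{1,n},\xi_{1,n}\in\mathbb R^n\setminus\{0\}$, all real $x_{n+1}<\xi_{n+1}$ and all $t\ge 2^{k+3}\dfrac{\xi_{n+1}-x_{n+1}}{|x_{1,n}|^k+|\xi_{1,n}|^k}$, $$\mathbb P[Y_t\le \xi_{n+1}-x_{n+1}]\le c_1\exp\left(-c_2\,\frac{|x_{1,n}|^{2+k}+|\xi_{1,n}|^{2+k}}{\xi_{n+1}-x_{n+1}}\right).$$ (b) For every $K\ge 0$ there are constants $\bar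 c_1,\bar c_2>0$ depending only on $(n,k,K)$ such that for all $x_{1,n},\xi_{1,n}\in\mathbb R^n$, all real $x_{n+1}<\xi_{n+1}$ and all $t>0$ with $t\ge\big[(\xi_{n+1}-x_{n+1})\tfrac34(64K)^k\big]^{2/(k+2)}$ and $\max(|x_{1,n}|,|\xi_{1,n}|)\le K t^{1/2}$, $$\mathbb P[Y_t\le \xi_{n+1}-x_{n+1}]\le \bar c_1\exp\left(-\bar c_2\,\frac{t^{1+2/k}}{(\xi_{n+1}-x_{n+1})^{2/k}}\right).$$ -/

import Mathlib

open MeasureTheory ProbabilityTheory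

universe v

/-- `W` is (on the time interval `[0, t]`) a standard `n`-dimensional Brownian bridge from `0` to
`0` under `P`: a centred Gaussian process on `[0, t]`, with independent coordinates, each having
covariance function `(s, u) ↦ s ∧ u - s u / t`, and with almost surely continuous paths.
The values of `W` at times outside `[0, t]` play no role. -/
structure IsStandardBrownianBridge {Ω : Type*} [MeasurableSpace Ω] {n : ℕ} (t : ℝ)
    (W : ℝ → Ω → EuclideanSpace ℝ (Fin n)) (P : Measure Ω) : Prop where
  isGaussianProcess : IsGaussianProcess (fun s : Set.Icc (0 : ℝ) t => W s) P
  integral_eq_zero : ∀ s ∈ Set.Icc (0 : ℝ) t, ∫ ω, W s ω ∂P = 0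
  covariance_eq : ∀ s ∈ Set.Icc (0 : ℝ) t, ∀ u ∈ Set.Icc (0 : ℝ) t, ∀ i j : Fin n,
    cov[fun ω => W s ω i, fun ω => W u ω j; P] = if i = j then min s u - s * u / t else 0
  continuousOn : ∀ᵐ ω ∂P, ContinuousOn (fun s => W s ω) (Set.Icc (0 : ℝ) t)

/-- The functional `Y_t = ∫₀ᵗ |x (t - u) / t + ξ u / t + W_u|ᵏ du`, where `|·|` is the Euclidean
norm of `ℝⁿ`. -/
noncomputable def bridgeFunctional {Ω : Type*} {n : ℕ} (k : ℕ) (t : ℝ)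
    (x ξ : EuclideanSpace ℝ (Fin n)) (W : ℝ → Ω → EuclideanSpace ℝ (Fin n)) (ω : Ω) : ℝ :=
  ∫ u in (0 : ℝ)..t, ‖((t - u) / t) • x + (u / t) • ξ + W u ω‖ ^ k

/-! Write Z for the path inside the norm and D for ξ_{n+1} - x_{n+1}. (a) Time reversal exchanges
the endpoints, so assume |ξ| ≤ |x|. Take s with s(|x|/2)^k = D; the hypothesis on t gives 4s ≤ t. If
Y_t ≤ D, Jensen bounds the average of |Z| over [0, s] by |x|/2, whereas the affine part, projected
on e = x/|x|, averages at least 3|x|/4 there. So ⟨e, W⟩ averages at most -|x|/4 over [0, s]. As ⟨e,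
W_u⟩ is Gaussian of variance at most s, Chernoff gives exp(-|x|²/(32s)), which is the claimed bound
(`measure_bridgeFunctional_le_of_norm_le`).

(b) Put D = tη^k and project on a coordinate. Y_t ≤ D forces a squared L² norm of at most 2tη².
Second differences of step r annihilate the affine part, so the endpoints disappear from the
estimate. Cut [0, t] into N blocks of length 3r: for a fixed offset θ, the second differences taken
one per block are independent centred Gaussians of variance 2r, and averaging their squares over θ
in [0, r] is controlled by the L² norm. With r of order η², each block contributes a factor 1/9 to
the Laplace transform, Chernoff costs e per block, and e/9 < 1/e leaves exp(-N) with N of order t/η²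
(`measure_integral_sq_le`).

Both parts need the exponential moment of a time average; convexity of exp reduces it to fixed times
(`lintegral_exp_average_le`). -/

/-! ### Time averages, their exponential moments, and a Gaussian Laplace transform. -/

open Filter Topology Set Finset in
/-- Riemann sums of a continuous function converge to its average. -/
lemma tendsto_riemannSum_average {f : ℝ → ℝ} {r : ℝ} (hr : 0 < r)
    (hf : ContinuousOn f (Set.Icc 0 r)) :
    Tendsto (fun m : ℕ => ((m : ℝ) + 1)⁻¹ * ∑ l ∈ Finset.range (m + 1), f (l * (r / (m + 1))))
      atTop (𝓝 (r⁻¹ * ∫ u in (0 : ℝ)..r, f u)) := by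
  rw [Metric.tendsto_atTop]
  intro ε hε
  have huc := isCompact_Icc.uniformContinuousOn_of_continuous hf
  rw [Metric.uniformContinuousOn_iff] at huc
  obtain ⟨δ, hδ, hfδ⟩ := huc (ε / 2) (by positivity)
  obtain ⟨M, hM⟩ := exists_nat_gt (r / δ)
  refine ⟨M, fun m hm => ?_⟩
  have hm1 : (0 : ℝ) < (m : ℝ) + 1 := by positivity
  set w : ℝ := r / (m + 1) with hw
  have hw0 : 0 < w := by positivity
  have hwδ : w < δ := by
    rw [hw, div_lt_iff₀ hm1]
    rw [div_lt_iff₀ hδ] at hM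
    have : (M : ℝ) ≤ m := by exact_mod_cast hm
    nlinarith
  have hrw : r = ((m + 1 : ℕ) : ℝ) * w := by rw [hw]; push_cast; field_simp
  have hsub : ∀ l ∈ Finset.range (m + 1), ∀ u ∈ Set.Icc ((l : ℝ) * w) ((l + 1 : ℕ) * w),
      u ∈ Set.Icc 0 r := by
    intro l hl u hu
    have hl' : ((l + 1 : ℕ) : ℝ) ≤ (m + 1 : ℕ) := by
      exact_mod_cast Finset.mem_range.1 hl
    refine ⟨le_trans (by positivity) hu.1, hu.2.trans ?_⟩
    rw [hrw]; gcongr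
  have hle : ∀ l : ℕ, (l : ℝ) * w ≤ (l + 1 : ℕ) * w := by
    intro l; push_cast; nlinarith
  have hint : ∀ l < m + 1, IntervalIntegrable f volume ((l : ℝ) * w) ((l + 1 : ℕ) * w) := by
    intro l hl
    apply ContinuousOn.intervalIntegrable
    rw [Set.uIcc_of_le (hle l)]
    exact hf.mono (hsub l (Finset.mem_range.2 hl))
  have hsum : ∑ l ∈ Finset.range (m + 1), ∫ u in ((l : ℝ) * w)..((l + 1 : ℕ) * w), f u
      = ∫ u in (0 : ℝ)..r, f u := by
    have := intervalIntegral.sum_integral_adjacent_intervals (a := fun l : ℕ => (l : ℝ) * w) hint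
    rw [this, ← hrw]; simp
  have hpiece : ∀ l ∈ Finset.range (m + 1),
      |w * f (l * w) - ∫ u in ((l : ℝ) * w)..((l + 1 : ℕ) * w), f u| ≤ ε / 2 * w := by
    intro l hl
    have h1 : w * f (l * w) = ∫ u in ((l : ℝ) * w)..((l + 1 : ℕ) * w), f (l * w) := by
      rw [intervalIntegral.integral_const, smul_eq_mul]; push_cast; ring
    rw [h1, ← intervalIntegral.integral_sub (by simp) (hint l (Finset.mem_range.1 hl))]
    have h2 := intervalIntegral.norm_integral_le_of_norm_le_const (C := ε / 2)
      (a := (l : ℝ) * w) (b := (l + 1 : ℕ) * w) (f := fun u => f (l * w) - f u) ?_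
    · refine h2.trans (le_of_eq ?_)
      have : ((l + 1 : ℕ) : ℝ) * w - l * w = w := by push_cast; ring
      rw [this, abs_of_pos hw0]
    · intro u hu
      rw [Set.uIoc_of_le (hle l)] at hu
      have hu' : u ∈ Set.Icc ((l : ℝ) * w) ((l + 1 : ℕ) * w) := ⟨hu.1.le, hu.2⟩
      have := hfδ _ (hsub l hl _ ⟨le_rfl, hle l⟩) _ (hsub l hl u hu') ?_
      · rw [← dist_eq_norm]; exact this.le
      · rw [Real.dist_eq, abs_sub_comm, abs_of_nonneg (by linarith [hu.1])]
        have := hu.2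
        push_cast at this
        nlinarith
  have htot : |w * ∑ l ∈ Finset.range (m + 1), f (l * w) - ∫ u in (0 : ℝ)..r, f u| ≤ ε / 2 * r := by
    rw [← hsum, Finset.mul_sum, ← Finset.sum_sub_distrib]
    refine (Finset.abs_sum_le_sum_abs _ _).trans ((Finset.sum_le_sum hpiece).trans (le_of_eq ?_))
    rw [Finset.sum_const, Finset.card_range, nsmul_eq_mul]
    conv_rhs => rw [hrw]
    ring
  have heq : ((m : ℝ) + 1)⁻¹ * ∑ l ∈ Finset.range (m + 1), f (l * w) - r⁻¹ * ∫ u in (0 : ℝ)..r, f u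
      = r⁻¹ * (w * ∑ l ∈ Finset.range (m + 1), f (l * w) - ∫ u in (0 : ℝ)..r, f u) := by
    rw [mul_sub, ← mul_assoc]
    congr 2
    rw [hw]; field_simp
  rw [Real.dist_eq, heq, abs_mul, abs_of_pos (inv_pos.2 hr)]
  calc r⁻¹ * _ ≤ r⁻¹ * (ε / 2 * r) := by gcongr
    _ = ε / 2 := by field_simp
    _ < ε := by linarith

section

variable {Ω : Type*} [MeasurableSpace Ω] {P : Measure Ω}

lemma mul_div_succ_mem_Icc {r : ℝ} (hr : 0 < r) {m l : ℕ} (hl : l ∈ Finset.range (m + 1)) :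
    (l : ℝ) * (r / (m + 1)) ∈ Set.Icc 0 r := by
  have hl' : (l : ℝ) ≤ m + 1 := by exact_mod_cast (Finset.mem_range.1 hl).le
  refine ⟨by positivity, ?_⟩
  calc (l : ℝ) * (r / (m + 1)) ≤ (m + 1) * (r / (m + 1)) := by gcongr
    _ = r := by field_simp

/-- Joint measurability in time and ω is not assumed, so measurability of the integral comes from
Riemann sums, which involve fixed times only. -/
lemma aemeasurable_average {g : ℝ → Ω → ℝ} {r : ℝ} (hr : 0 < r)
    (hcont : ∀ᵐ ω ∂P, ContinuousOn (fun u => g u ω) (Set.Icc 0 r))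
    (hmeas : ∀ u ∈ Set.Icc 0 r, AEMeasurable (g u) P) :
    AEMeasurable (fun ω => r⁻¹ * ∫ u in (0 : ℝ)..r, g u ω) P := by
  refine aemeasurable_of_tendsto_metrizable_ae' (f := fun (m : ℕ) ω => ((m : ℝ) + 1)⁻¹ *
    ∑ l ∈ Finset.range (m + 1), g (l * (r / (m + 1))) ω) (fun m => ?_) ?_
  · refine AEMeasurable.const_mul ?_ _
    exact Finset.aemeasurable_fun_sum _ fun l hl => hmeas _ (mul_div_succ_mem_Icc hr hl)
  · filter_upwards [hcont] with ω hω using tendsto_riemannSum_average hr hω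

/-- Jensen's inequality for the exponential of the time average of a continuous process. -/
lemma lintegral_exp_average_le {g : ℝ → Ω → ℝ} {r : ℝ} (hr : 0 < r)
    (hcont : ∀ᵐ ω ∂P, ContinuousOn (fun u => g u ω) (Set.Icc 0 r))
    (hmeas : ∀ u ∈ Set.Icc 0 r, AEMeasurable (g u) P) {C : ENNReal}
    (hC : ∀ u ∈ Set.Icc 0 r, ∫⁻ ω, ENNReal.ofReal (Real.exp (g u ω)) ∂P ≤ C) :
    ∫⁻ ω, ENNReal.ofReal (Real.exp (r⁻¹ * ∫ u in (0 : ℝ)..r, g u ω)) ∂P ≤ C := by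
  let F : ℕ → Ω → ENNReal := fun m ω => ENNReal.ofReal (Real.exp (((m : ℝ) + 1)⁻¹ *
    ∑ l ∈ Finset.range (m + 1), g (l * (r / (m + 1))) ω))
  have hF : ∀ m, AEMeasurable (F m) P := fun m =>
    ((Real.measurable_exp.comp_aemeasurable (AEMeasurable.const_mul
      (Finset.aemeasurable_fun_sum _ fun l hl => hmeas _ (mul_div_succ_mem_Icc hr hl)) _))).ennreal_ofReal
  have hFC : ∀ m, ∫⁻ ω, F m ω ∂P ≤ C := by
    intro m
    have hm1 : (0 : ℝ) < (m : ℝ) + 1 := by positivity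
    have hpt : ∀ ω, F m ω ≤ ENNReal.ofReal ((m : ℝ) + 1)⁻¹ *
        ∑ l ∈ Finset.range (m + 1), ENNReal.ofReal (Real.exp (g (l * (r / (m + 1))) ω)) := by
      intro ω
      rw [← ENNReal.ofReal_sum_of_nonneg (fun _ _ => (Real.exp_pos _).le),
        ← ENNReal.ofReal_mul (by positivity)]
      refine ENNReal.ofReal_le_ofReal ?_
      have := convexOn_exp.map_sum_le (t := Finset.range (m + 1)) (w := fun _ => ((m : ℝ) + 1)⁻¹)
        (p := fun l : ℕ => g (l * (r / (m + 1))) ω) (fun _ _ => by positivity)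
        (by simp [hm1.ne']) (fun _ _ => Set.mem_univ _)
      simpa [Finset.mul_sum] using this
    calc ∫⁻ ω, F m ω ∂P ≤ ∫⁻ ω, ENNReal.ofReal ((m : ℝ) + 1)⁻¹ *
        ∑ l ∈ Finset.range (m + 1), ENNReal.ofReal (Real.exp (g (l * (r / (m + 1))) ω)) ∂P :=
          lintegral_mono hpt
      _ = ENNReal.ofReal ((m : ℝ) + 1)⁻¹ * ∑ l ∈ Finset.range (m + 1),
            ∫⁻ ω, ENNReal.ofReal (Real.exp (g (l * (r / (m + 1))) ω)) ∂P := by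
          rw [lintegral_const_mul' _ _ ENNReal.ofReal_ne_top, lintegral_finsetSum']
          intro l hl
          exact (hmeas _ (mul_div_succ_mem_Icc hr hl)).exp.ennreal_ofReal
      _ ≤ ENNReal.ofReal ((m : ℝ) + 1)⁻¹ * ∑ l ∈ Finset.range (m + 1), C := by
          gcongr with l hl
          exact hC _ (mul_div_succ_mem_Icc hr hl)
      _ = C := by
          rw [Finset.sum_const, Finset.card_range, nsmul_eq_mul, ← mul_assoc,
            ENNReal.ofReal_inv_of_pos hm1]
          have : ENNReal.ofReal ((m : ℝ) + 1) = ((m + 1 : ℕ) : ENNReal) := by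
            rw [← ENNReal.ofReal_natCast]; push_cast; rfl
          rw [this, ENNReal.inv_mul_cancel (by simp) (by simp), one_mul]
  -- The discrete Jensen bound passes to the continuous average by Fatou, which avoids Fubini.
  calc ∫⁻ ω, ENNReal.ofReal (Real.exp (r⁻¹ * ∫ u in (0 : ℝ)..r, g u ω)) ∂P
      = ∫⁻ ω, Filter.liminf (fun m => F m ω) Filter.atTop ∂P := by
        refine lintegral_congr_ae ?_
        filter_upwards [hcont] with ω hω
        refine (Filter.Tendsto.liminf_eq ?_).symm
        exact (ENNReal.continuous_ofReal.comp Real.continuous_exp).continuousAt.tendsto.comp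
          (tendsto_riemannSum_average hr hω)
    _ ≤ Filter.liminf (fun m => ∫⁻ ω, F m ω ∂P) Filter.atTop := lintegral_liminf_le' hF
    _ ≤ C := by
        refine Filter.liminf_le_of_le (by isBoundedDefault) fun b hb => ?_
        obtain ⟨m, hm⟩ := hb.exists
        exact hm.trans (hFC m)

/-- Chernoff bound for the time average of a continuous process. -/
lemma measure_le_average_le {g : ℝ → Ω → ℝ} {r : ℝ} (hr : 0 < r)
    (hcont : ∀ᵐ ω ∂P, ContinuousOn (fun u => g u ω) (Set.Icc 0 r))
    (hmeas : ∀ u ∈ Set.Icc 0 r, AEMeasurable (g u) P) {C : ENNReal}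
    (hC : ∀ u ∈ Set.Icc 0 r, ∫⁻ ω, ENNReal.ofReal (Real.exp (g u ω)) ∂P ≤ C) (a : ℝ) :
    P {ω | a ≤ r⁻¹ * ∫ u in (0 : ℝ)..r, g u ω} ≤ ENNReal.ofReal (Real.exp (-a)) * C := by
  have h1 := mul_meas_ge_le_lintegral₀
    (aemeasurable_average hr hcont hmeas).exp.ennreal_ofReal (ENNReal.ofReal (Real.exp a))
  have h2 := h1.trans (lintegral_exp_average_le hr hcont hmeas hC)
  have hset : {ω | a ≤ r⁻¹ * ∫ u in (0 : ℝ)..r, g u ω} ⊆ {ω | ENNReal.ofReal (Real.exp a) ≤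
      ENNReal.ofReal (Real.exp (r⁻¹ * ∫ u in (0 : ℝ)..r, g u ω))} := fun ω hω =>
    ENNReal.ofReal_le_ofReal (Real.exp_le_exp.2 hω)
  calc P {ω | a ≤ r⁻¹ * ∫ u in (0 : ℝ)..r, g u ω}
      = ENNReal.ofReal (Real.exp (-a)) * (ENNReal.ofReal (Real.exp a) *
          P {ω | a ≤ r⁻¹ * ∫ u in (0 : ℝ)..r, g u ω}) := by
        rw [← mul_assoc, ← ENNReal.ofReal_mul (Real.exp_pos _).le, ← Real.exp_add]; simp
    _ ≤ ENNReal.ofReal (Real.exp (-a)) * C := by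
        gcongr
        exact le_trans (by gcongr) h2

/-- Laplace transform of the square of a centred Gaussian variable with large variance. -/
lemma integral_exp_neg_mul_sq_le_of_hasGaussianLaw {X : Ω → ℝ} (hX : HasGaussianLaw X P)
    (h0 : ∫ ω, X ω ∂P = 0) {c : ℝ} (hc : 0 < c) (hv : 81 ≤ 2 * c * Var[X; P]) :
    ∫ ω, Real.exp (-c * X ω ^ 2) ∂P ≤ 1 / 9 := by
  set v := Var[X; P] with hvdef
  have hv0 : 0 < v := by nlinarith
  have hmap := hX.map_eq_gaussianReal
  rw [h0, ← hvdef] at hmap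
  have hne : v.toNNReal ≠ 0 := by simpa using hv0
  have h1 : ∫ ω, Real.exp (-c * X ω ^ 2) ∂P
      = ∫ x, Real.exp (-c * x ^ 2) ∂(gaussianReal 0 v.toNNReal) := by
    rw [← hmap, integral_map hX.aemeasurable (by fun_prop)]
  have hvc : ((v.toNNReal : NNReal) : ℝ) = v := Real.coe_toNNReal _ hv0.le
  rw [h1, integral_gaussianReal_eq_integral_smul hne]
  have hs : 0 < √(2 * Real.pi * v) := by positivity
  -- Replacing the density by its maximum leaves 1/√(2cv), hence the threshold 81 = 9².
  calc ∫ x, gaussianPDFReal 0 v.toNNReal x • Real.exp (-c * x ^ 2)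
      ≤ ∫ x, (√(2 * Real.pi * v))⁻¹ * Real.exp (-c * x ^ 2) := by
        refine integral_mono_of_nonneg ?_ ((integrable_exp_neg_mul_sq hc).const_mul _) ?_
        · exact Filter.Eventually.of_forall fun x =>
            mul_nonneg (gaussianPDFReal_nonneg _ _ _) (Real.exp_pos _).le
        · refine Filter.Eventually.of_forall fun x => ?_
          simp only [smul_eq_mul]
          gcongr
          rw [gaussianPDFReal, hvc]
          refine mul_le_of_le_one_right (by positivity) (Real.exp_le_one_iff.2 ?_)
          rw [neg_div]
          exact neg_nonpos.2 (by positivity)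
    _ = (√(2 * Real.pi * v))⁻¹ * √(Real.pi / c) := by
        rw [integral_const_mul, integral_gaussian]
    _ ≤ 1 / 9 := by
        rw [inv_mul_le_iff₀ hs]
        refine Real.sqrt_le_iff.2 ⟨by positivity, ?_⟩
        rw [mul_pow, Real.sq_sqrt (by positivity), div_le_iff₀ hc]
        nlinarith [Real.pi_pos]

end

/-! ### Real Brownian bridges: projections, Gaussian tails, second differences. -/

/-- `B` is a real Brownian bridge from `0` to `0` on the time interval `[0, t]`. -/
structure IsRealBrownianBridge {Ω : Type*} [MeasurableSpace Ω] (t : ℝ)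
    (B : ℝ → Ω → ℝ) (P : Measure Ω) : Prop where
  isGaussianProcess : IsGaussianProcess (fun s : Set.Icc (0 : ℝ) t => B s) P
  integral_eq_zero : ∀ s ∈ Set.Icc (0 : ℝ) t, ∫ ω, B s ω ∂P = 0
  covariance_eq : ∀ s ∈ Set.Icc (0 : ℝ) t, ∀ u ∈ Set.Icc (0 : ℝ) t,
    cov[B s, B u; P] = min s u - s * u / t
  continuousOn : ∀ᵐ ω ∂P, ContinuousOn (fun s => B s ω) (Set.Icc (0 : ℝ) t)

section

variable {Ω : Type*} [MeasurableSpace Ω] {P : Measure Ω}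

/-- The component of a Brownian bridge in a unit direction is a real Brownian bridge. -/
lemma IsStandardBrownianBridge.inner_left {n : ℕ} {t : ℝ} {W : ℝ → Ω → EuclideanSpace ℝ (Fin n)}
    (hW : IsStandardBrownianBridge t W P) {e : EuclideanSpace ℝ (Fin n)} (he : ‖e‖ = 1) :
    IsRealBrownianBridge t (fun s ω => inner ℝ e (W s ω)) P where
  isGaussianProcess := hW.isGaussianProcess.comp_left (fun _ => innerSL ℝ e)
  integral_eq_zero s hs := by
    have := (hW.isGaussianProcess.hasGaussianLaw_eval ⟨s, hs⟩).integrable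
    rw [integral_inner this, hW.integral_eq_zero s hs, inner_zero_right]
  covariance_eq s hs u hu := by
    have := hW.isGaussianProcess.isProbabilityMeasure
    have hLp : ∀ v ∈ Set.Icc (0 : ℝ) t, ∀ i, MemLp (fun ω => e i * W v ω i) 2 P := fun v hv i =>
      ((hW.isGaussianProcess.hasGaussianLaw_eval ⟨v, hv⟩).map
        (EuclideanSpace.proj i)).memLp_two.const_mul _
    have hin : ∀ v ω, inner ℝ e (W v ω) = ∑ i, e i * W v ω i := fun v ω => by
      simp [PiLp.inner_apply, mul_comm]
    simp_rw [hin]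
    rw [covariance_fun_sum_fun_sum (hLp s hs) (hLp u hu)]
    simp_rw [covariance_const_mul_left, covariance_const_mul_right, hW.covariance_eq s hs u hu]
    have hnorm : ∑ i, e i * e i = 1 := by
      have := EuclideanSpace.norm_sq_eq e
      rw [he] at this
      simpa [sq] using this.symm
    simp only [mul_ite, mul_zero, Finset.sum_ite_eq, Finset.mem_univ, if_true]
    calc ∑ i, e i * (e i * (min s u - s * u / t))
        = (∑ i, e i * e i) * (min s u - s * u / t) := by
          rw [Finset.sum_mul]; exact Finset.sum_congr rfl fun _ _ => by ring
      _ = _ := by rw [hnorm, one_mul]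
  continuousOn := by
    filter_upwards [hW.continuousOn] with ω hω
    exact continuousOn_const.inner hω

/-- The time reversal of a Brownian bridge is a Brownian bridge. -/
lemma IsStandardBrownianBridge.reverse {n : ℕ} {t : ℝ} {W : ℝ → Ω → EuclideanSpace ℝ (Fin n)}
    (ht : 0 < t) (hW : IsStandardBrownianBridge t W P) :
    IsStandardBrownianBridge t (fun s => W (t - s)) P := by
  have hmem : ∀ s ∈ Set.Icc (0 : ℝ) t, t - s ∈ Set.Icc (0 : ℝ) t := fun s hs =>
    ⟨by linarith [hs.2], by linarith [hs.1]⟩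
  refine ⟨?_, fun s hs => hW.integral_eq_zero _ (hmem s hs), fun s hs u hu i j => ?_, ?_⟩
  · exact hW.isGaussianProcess.comp_right
      fun s : Set.Icc (0 : ℝ) t => (⟨t - s, hmem s s.2⟩ : Set.Icc (0 : ℝ) t)
  · rw [hW.covariance_eq _ (hmem s hs) _ (hmem u hu)]
    split_ifs
    · rw [min_sub_sub_left]
      have : max s u = s + u - min s u := by linarith [min_add_max s u]
      rw [this]; field_simp; ring
    · rfl
  · filter_upwards [hW.continuousOn] with ω hω
    exact hω.comp (by fun_prop) hmem

namespace IsRealBrownianBridge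

variable {t : ℝ} {B : ℝ → Ω → ℝ}

lemma hasGaussianLaw (hB : IsRealBrownianBridge t B P) {s : ℝ} (hs : s ∈ Set.Icc (0 : ℝ) t) :
    HasGaussianLaw (B s) P :=
  hB.isGaussianProcess.hasGaussianLaw_eval ⟨s, hs⟩

/-- Gaussian tail of the average of a bridge over an initial time interval. -/
lemma measure_average_le (hB : IsRealBrownianBridge t B P) {s d : ℝ} (hs : 0 < s) (hst : s ≤ t)
    (hd : 0 < d) :
    P {ω | s⁻¹ * ∫ u in (0 : ℝ)..s, B u ω ≤ -d} ≤ ENNReal.ofReal (Real.exp (-(d ^ 2 / (2 * s)))) := by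
  have hsub : Set.Icc 0 s ⊆ Set.Icc 0 t := Set.Icc_subset_Icc_right hst
  have ht : 0 < t := hs.trans_le hst
  have := hB.isGaussianProcess.isProbabilityMeasure
  -- The slope λ = d/s minimises -λd + λ²s/2, the Chernoff exponent for variance at most s.
  have key := measure_le_average_le (P := P) (g := fun u ω => (-(d / s)) * B u ω) hs
    (C := ENNReal.ofReal (Real.exp (d ^ 2 / (2 * s)))) ?_ ?_ ?_ (d ^ 2 / s)
  · rw [← ENNReal.ofReal_mul (Real.exp_pos _).le, ← Real.exp_add] at key
    have he : -(d ^ 2 / s) + d ^ 2 / (2 * s) = -(d ^ 2 / (2 * s)) := by field_simp; ring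
    rw [he] at key
    refine le_trans (measure_mono fun ω hω => ?_) key
    simp only [Set.mem_ofPred_eq] at hω ⊢
    rw [intervalIntegral.integral_const_mul]
    have : d / s * (s⁻¹ * ∫ u in (0 : ℝ)..s, B u ω) ≤ d / s * (-d) := by gcongr
    have h2 : d / s * (-d) = - (d ^ 2 / s) := by ring
    linarith
  · filter_upwards [hB.continuousOn] with ω hω
    exact continuousOn_const.mul (hω.mono hsub)
  · exact fun u hu => (hB.hasGaussianLaw (hsub hu)).aemeasurable.const_mul _
  · intro u hu
    have hG := hB.hasGaussianLaw (hsub hu)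
    have hmap := hG.map_eq_gaussianReal
    have hvar : Var[B u; P] = u - u * u / t := by
      rw [← covariance_self hG.aemeasurable, hB.covariance_eq u (hsub hu) u (hsub hu), min_self]
    have hu0 := hu.1
    have hvar' : Var[B u; P] ≤ s := by
      rw [hvar]; have : 0 ≤ u * u / t := by positivity
      linarith [hu.2]
    have hint : Integrable (fun ω => Real.exp (-(d / s) * B u ω)) P := by
      have h := integrable_exp_mul_gaussianReal (μ := P[B u]) (v := Var[B u; P].toNNReal) (-(d / s))
      rw [← hmap] at h
      exact (integrable_map_measure (by fun_prop) hG.aemeasurable).1 h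
    rw [← ofReal_integral_eq_lintegral_ofReal hint
      (Filter.Eventually.of_forall fun _ => (Real.exp_pos _).le)]
    have hmgf := mgf_gaussianReal hmap (-(d / s))
    rw [mgf] at hmgf
    rw [hmgf, hB.integral_eq_zero u (hsub hu), Real.coe_toNNReal _ (variance_nonneg _ _)]
    refine ENNReal.ofReal_le_ofReal (Real.exp_le_exp.2 ?_)
    calc 0 * -(d / s) + Var[B u; P] * (-(d / s)) ^ 2 / 2 ≤ 0 * -(d / s) + s * (-(d / s)) ^ 2 / 2 := by
          gcongr
      _ = d ^ 2 / (2 * s) := by field_simp; ring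

lemma covariance_increments (hB : IsRealBrownianBridge t B P) {a b c d : ℝ}
    (ha : a ∈ Set.Icc 0 t) (hb : b ∈ Set.Icc 0 t) (hc : c ∈ Set.Icc 0 t) (hd : d ∈ Set.Icc 0 t) :
    cov[fun ω => B b ω - B a ω, fun ω => B d ω - B c ω; P] =
      min b d - min b c - min a d + min a c - (b - a) * (d - c) / t := by
  have := hB.isGaussianProcess.isProbabilityMeasure
  rw [covariance_fun_sub_fun_sub (hB.hasGaussianLaw hb).memLp_two (hB.hasGaussianLaw ha).memLp_two
    (hB.hasGaussianLaw hd).memLp_two (hB.hasGaussianLaw hc).memLp_two,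
    hB.covariance_eq _ hb _ hd, hB.covariance_eq _ hb _ hc, hB.covariance_eq _ ha _ hd,
    hB.covariance_eq _ ha _ hc]
  ring

/-- The bridge correction -su/t is bilinear in the times, so it cancels between increments of equal
length; only the Brownian covariance survives. -/
lemma covariance_secondDifferences (hB : IsRealBrownianBridge t B P) {p q r : ℝ}
    (hp : p ∈ Set.Icc 0 t) (hp1 : p + r ∈ Set.Icc 0 t) (hp2 : p + 2 * r ∈ Set.Icc 0 t)
    (hq : q ∈ Set.Icc 0 t) (hq1 : q + r ∈ Set.Icc 0 t) (hq2 : q + 2 * r ∈ Set.Icc 0 t) :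
    cov[fun ω => (B (p + 2 * r) ω - B (p + r) ω) - (B (p + r) ω - B p ω),
        fun ω => (B (q + 2 * r) ω - B (q + r) ω) - (B (q + r) ω - B q ω); P] =
      min (p + 2 * r) (q + 2 * r) - 2 * min (p + 2 * r) (q + r) + min (p + 2 * r) q
      - 2 * min (p + r) (q + 2 * r) + 4 * min (p + r) (q + r) - 2 * min (p + r) q
      + min p (q + 2 * r) - 2 * min p (q + r) + min p q := by
  have := hB.isGaussianProcess.isProbabilityMeasure
  have hL : ∀ {a b : ℝ}, a ∈ Set.Icc 0 t → b ∈ Set.Icc 0 t →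
      MemLp (fun ω => B b ω - B a ω) 2 P := fun ha hb =>
    (hB.hasGaussianLaw hb).memLp_two.sub (hB.hasGaussianLaw ha).memLp_two
  rw [covariance_fun_sub_fun_sub (hL hp1 hp2) (hL hp hp1) (hL hq1 hq2) (hL hq hq1),
    hB.covariance_increments hp1 hp2 hq1 hq2, hB.covariance_increments hp1 hp2 hq hq1,
    hB.covariance_increments hp hp1 hq1 hq2, hB.covariance_increments hp hp1 hq hq1]
  ring

lemma hasGaussianLaw_secondDifferences (hB : IsRealBrownianBridge t B P) {ι : Type*} [Fintype ι]
    {p : ι → ℝ} {r : ℝ} (hp : ∀ i, p i ∈ Set.Icc 0 t) (hp1 : ∀ i, p i + r ∈ Set.Icc 0 t)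
    (hp2 : ∀ i, p i + 2 * r ∈ Set.Icc 0 t) :
    HasGaussianLaw (fun ω i =>
      (B (p i + 2 * r) ω - B (p i + r) ω) - (B (p i + r) ω - B (p i) ω)) P := by
  classical
  let I : Finset (Set.Icc (0 : ℝ) t) := Finset.univ.biUnion fun i : ι =>
    {⟨p i, hp i⟩, ⟨p i + r, hp1 i⟩, ⟨p i + 2 * r, hp2 i⟩}
  have h0 : ∀ i, (⟨p i, hp i⟩ : Set.Icc (0 : ℝ) t) ∈ I := fun i =>
    Finset.mem_biUnion.2 ⟨i, by simp, by simp⟩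
  have h1 : ∀ i, (⟨p i + r, hp1 i⟩ : Set.Icc (0 : ℝ) t) ∈ I := fun i =>
    Finset.mem_biUnion.2 ⟨i, by simp, by simp⟩
  have h2 : ∀ i, (⟨p i + 2 * r, hp2 i⟩ : Set.Icc (0 : ℝ) t) ∈ I := fun i =>
    Finset.mem_biUnion.2 ⟨i, by simp, by simp⟩
  let L : (I → ℝ) →L[ℝ] ι → ℝ := ContinuousLinearMap.pi fun i =>
    (ContinuousLinearMap.proj ⟨_, h2 i⟩ - ContinuousLinearMap.proj ⟨_, h1 i⟩)
      - (ContinuousLinearMap.proj ⟨_, h1 i⟩ - ContinuousLinearMap.proj ⟨_, h0 i⟩)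
  exact (hB.isGaussianProcess.hasGaussianLaw I).map L

/-- Laplace transform of a sum of squared second differences over disjoint time blocks. -/
lemma integral_exp_neg_sum_sq_secondDifferences_le (hB : IsRealBrownianBridge t B P) {N : ℕ}
    {θ r c : ℝ} (hr : 0 < r) (hθ : θ ∈ Set.Icc 0 r) (ht : 3 * N * r ≤ t) (hc : 0 < c)
    (hcr : 81 ≤ 4 * c * r) :
    ∫ ω, Real.exp (-c * ∑ j ∈ Finset.range N, ((B (3 * j * r + θ + 2 * r) ω
      - B (3 * j * r + θ + r) ω) - (B (3 * j * r + θ + r) ω - B (3 * j * r + θ) ω)) ^ 2) ∂P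
      ≤ (1 / 9) ^ N := by
  obtain ⟨hθ0, hθr⟩ := hθ
  let p : Fin N → ℝ := fun j => 3 * j * r + θ
  have hbd : ∀ j : Fin N, 3 * (j : ℝ) * r + 3 * r ≤ t := fun j => by
    have : ((j : ℕ) : ℝ) + 1 ≤ N := by exact_mod_cast j.2
    nlinarith
  have hj0 : ∀ j : Fin N, 0 ≤ 3 * (j : ℝ) * r := fun j => by positivity
  have hp : ∀ j, p j ∈ Set.Icc 0 t := fun j =>
    ⟨by simp only [p]; linarith [hj0 j], by simp only [p]; linarith [hbd j]⟩
  have hp1 : ∀ j, p j + r ∈ Set.Icc 0 t := fun j =>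
    ⟨by simp only [p]; linarith [hj0 j], by simp only [p]; linarith [hbd j]⟩
  have hp2 : ∀ j, p j + 2 * r ∈ Set.Icc 0 t := fun j =>
    ⟨by simp only [p]; linarith [hj0 j], by simp only [p]; linarith [hbd j]⟩
  let D : Fin N → Ω → ℝ := fun j ω =>
    (B (p j + 2 * r) ω - B (p j + r) ω) - (B (p j + r) ω - B (p j) ω)
  have hD : HasGaussianLaw (fun ω j => D j ω) P := hB.hasGaussianLaw_secondDifferences hp hp1 hp2
  have hDm : ∀ j, AEMeasurable (D j) P := fun j => (hD.eval j).aemeasurable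
  have hsep : ∀ i j : Fin N, i < j → cov[D i, D j; P] = 0 := by
    intro i j hij
    have hij' : p i + 3 * r ≤ p j := by
      have : ((i : ℕ) : ℝ) + 1 ≤ (j : ℕ) := by exact_mod_cast hij
      simp only [p]; nlinarith
    rw [hB.covariance_secondDifferences (hp i) (hp1 i) (hp2 i) (hp j) (hp1 j) (hp2 j)]
    -- All times of block i precede those of block j, so each minimum is its first argument, with
    -- total coefficient 1 - 2 + 1 = 0.
    repeat rw [min_eq_left (by linarith)]
    ring
  have hvar : ∀ j, Var[D j; P] = 2 * r := by
    intro j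
    rw [← covariance_self (hDm j),
      hB.covariance_secondDifferences (hp j) (hp1 j) (hp2 j) (hp j) (hp1 j) (hp2 j)]
    rw [min_self, min_self, min_self, min_eq_right (by linarith : p j + r ≤ p j + 2 * r),
      min_eq_left (by linarith : p j + r ≤ p j + 2 * r),
      min_eq_right (by linarith : p j ≤ p j + 2 * r), min_eq_left (by linarith : p j ≤ p j + 2 * r),
      min_eq_right (by linarith : p j ≤ p j + r), min_eq_left (by linarith : p j ≤ p j + r)]
    ring
  have hmean : ∀ j, ∫ ω, D j ω ∂P = 0 := by
    intro j
    have i0 := (hB.hasGaussianLaw (hp j)).integrable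
    have i1 := (hB.hasGaussianLaw (hp1 j)).integrable
    have i2 := (hB.hasGaussianLaw (hp2 j)).integrable
    have i21 : Integrable (fun ω => B (p j + 2 * r) ω - B (p j + r) ω) P := i2.sub i1
    have i10 : Integrable (fun ω => B (p j + r) ω - B (p j) ω) P := i1.sub i0
    simp only [D]
    rw [integral_sub i21 i10, integral_sub i2 i1, integral_sub i1 i0,
      hB.integral_eq_zero _ (hp j), hB.integral_eq_zero _ (hp1 j), hB.integral_eq_zero _ (hp2 j)]
    simp
  have hind : iIndepFun D P := hD.iIndepFun_of_covariance_eq_zero fun i j hij => by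
    rcases lt_or_gt_of_ne hij with h | h
    · exact hsep i j h
    · rw [covariance_comm]; exact hsep j i h
  have hprod : ∫ ω, ∏ j, Real.exp (-c * D j ω ^ 2) ∂P
      = ∏ j, ∫ ω, Real.exp (-c * D j ω ^ 2) ∂P :=
    hind.integral_fun_prod_comp (f := fun _ x => Real.exp (-c * x ^ 2)) hDm
      fun _ => Continuous.aestronglyMeasurable (by fun_prop)
  calc _ = ∫ ω, ∏ j, Real.exp (-c * D j ω ^ 2) ∂P := by
        congr 1 with ω
        rw [← Real.exp_sum, ← Finset.mul_sum, Finset.sum_range]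
    _ ≤ ∏ j : Fin N, (1 / 9 : ℝ) := by
        rw [hprod]
        refine Finset.prod_le_prod (fun j _ => integral_nonneg fun _ => (Real.exp_pos _).le)
          fun j _ => ?_
        refine integral_exp_neg_mul_sq_le_of_hasGaussianLaw (hD.eval j) (hmean j) hc ?_
        rw [hvar]; linarith
    _ = (1 / 9) ^ N := by simp

end IsRealBrownianBridge

end

/-! ### Second differences against the L² norm, and the L² small ball estimate. -/

/-- As θ runs over [0, r], the three sample points sweep the three thirds of the block. The constant
is 6 = 1² + 2² + 1², by Cauchy–Schwarz. -/
lemma integral_sq_secondDifference_le {f : ℝ → ℝ} {a r : ℝ} (hr : 0 < r)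
    (hf : ContinuousOn f (Set.Icc a (a + 3 * r))) :
    ∫ θ in (0 : ℝ)..r, ((f (a + θ + 2 * r) - f (a + θ + r)) - (f (a + θ + r) - f (a + θ))) ^ 2
      ≤ 6 * ∫ u in a..(a + 3 * r), f u ^ 2 := by
  have hc0 : ContinuousOn (fun θ => f (a + θ)) (Set.uIcc 0 r) := by
    rw [Set.uIcc_of_le hr.le]
    exact hf.comp (by fun_prop) fun θ hθ => ⟨by linarith [hθ.1], by linarith [hθ.2]⟩
  have hc1 : ContinuousOn (fun θ => f (a + θ + r)) (Set.uIcc 0 r) := by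
    rw [Set.uIcc_of_le hr.le]
    exact hf.comp (by fun_prop) fun θ hθ => ⟨by linarith [hθ.1], by linarith [hθ.2]⟩
  have hc2 : ContinuousOn (fun θ => f (a + θ + 2 * r)) (Set.uIcc 0 r) := by
    rw [Set.uIcc_of_le hr.le]
    exact hf.comp (by fun_prop) fun θ hθ => ⟨by linarith [hθ.1], by linarith [hθ.2]⟩
  have hsub : ∀ b c, a ≤ b → b ≤ c → c ≤ a + 3 * r →
      IntervalIntegrable (fun u => f u ^ 2) volume b c := fun b c h1 h2 h3 => by
    apply ContinuousOn.intervalIntegrable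
    rw [Set.uIcc_of_le h2]
    exact (hf.mono (Set.Icc_subset_Icc h1 h3)).pow 2
  have hs0 : ∫ θ in (0 : ℝ)..r, f (a + θ) ^ 2 = ∫ u in a..(a + r), f u ^ 2 := by
    rw [intervalIntegral.integral_comp_add_left (fun u => f u ^ 2), add_zero]
  have hs1 : ∫ θ in (0 : ℝ)..r, f (a + θ + r) ^ 2 = ∫ u in (a + r)..(a + 2 * r), f u ^ 2 := by
    have := intervalIntegral.integral_comp_add_left (fun u => f u ^ 2) (a + r) (a := 0) (b := r)
    rw [add_zero, show a + r + r = a + 2 * r by ring] at this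
    rw [← this]
    congr 1 with θ; rw [show a + θ + r = a + r + θ by ring]
  have hs2 : ∫ θ in (0 : ℝ)..r, f (a + θ + 2 * r) ^ 2
      = ∫ u in (a + 2 * r)..(a + 3 * r), f u ^ 2 := by
    have := intervalIntegral.integral_comp_add_left (fun u => f u ^ 2) (a + 2 * r) (a := 0) (b := r)
    rw [add_zero, show a + 2 * r + r = a + 3 * r by ring] at this
    rw [← this]
    congr 1 with θ; rw [show a + θ + 2 * r = a + 2 * r + θ by ring]
  have i0 : IntervalIntegrable (fun θ => f (a + θ) ^ 2) volume 0 r :=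
    (hc0.pow 2).intervalIntegrable
  have i1 : IntervalIntegrable (fun θ => f (a + θ + r) ^ 2) volume 0 r :=
    (hc1.pow 2).intervalIntegrable
  have i2 : IntervalIntegrable (fun θ => f (a + θ + 2 * r) ^ 2) volume 0 r :=
    (hc2.pow 2).intervalIntegrable
  calc _ ≤ ∫ θ in (0 : ℝ)..r, 6 * ((f (a + θ) ^ 2 + f (a + θ + r) ^ 2) + f (a + θ + 2 * r) ^ 2) := by
        refine intervalIntegral.integral_mono_on hr.le ?_ (((i0.add i1).add i2).const_mul 6) ?_
        · exact (((hc2.sub hc1).sub (hc1.sub hc0)).pow 2).intervalIntegrable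
        · intro θ _
          -- By Lagrange's identity, these three squares add up exactly to the difference of the two
          -- sides.
          nlinarith [sq_nonneg (f (a + θ) - f (a + θ + 2 * r)),
            sq_nonneg (2 * f (a + θ) + f (a + θ + r)),
            sq_nonneg (2 * f (a + θ + 2 * r) + f (a + θ + r))]
    _ = 6 * ((∫ θ in (0 : ℝ)..r, f (a + θ) ^ 2) + (∫ θ in (0 : ℝ)..r, f (a + θ + r) ^ 2)
          + ∫ θ in (0 : ℝ)..r, f (a + θ + 2 * r) ^ 2) := by
        rw [intervalIntegral.integral_const_mul, intervalIntegral.integral_add (i0.add i1) i2,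
          intervalIntegral.integral_add i0 i1]
    _ = _ := by
        rw [hs0, hs1, hs2, intervalIntegral.integral_add_adjacent_intervals,
          intervalIntegral.integral_add_adjacent_intervals]
        all_goals refine hsub _ _ ?_ ?_ ?_ <;> linarith

lemma integral_sum_sq_secondDifferences_le {f : ℝ → ℝ} {r : ℝ} (hr : 0 < r) (N : ℕ)
    (hf : ContinuousOn f (Set.Icc 0 (3 * N * r))) :
    ∫ θ in (0 : ℝ)..r, ∑ j ∈ Finset.range N, ((f (3 * j * r + θ + 2 * r) - f (3 * j * r + θ + r))
        - (f (3 * j * r + θ + r) - f (3 * j * r + θ))) ^ 2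
      ≤ 6 * ∫ u in (0 : ℝ)..(3 * N * r), f u ^ 2 := by
  have hsub : ∀ j ∈ Finset.range N,
      Set.Icc (3 * (j : ℝ) * r) (3 * j * r + 3 * r) ⊆ Set.Icc 0 (3 * N * r) := fun j hj => by
    have : (j : ℝ) + 1 ≤ N := by exact_mod_cast Finset.mem_range.1 hj
    exact Set.Icc_subset_Icc (by positivity) (by nlinarith)
  have hend : ∀ j : ℕ, 3 * ((j + 1 : ℕ) : ℝ) * r = 3 * j * r + 3 * r := fun j => by
    push_cast; ring
  rw [intervalIntegral.integral_finsetSum]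
  · have hsum := intervalIntegral.sum_integral_adjacent_intervals (f := fun u => f u ^ 2)
      (μ := volume) (a := fun j : ℕ => 3 * (j : ℝ) * r) (n := N) fun j hj => by
        apply ContinuousOn.intervalIntegrable
        rw [hend, Set.uIcc_of_le (by linarith)]
        exact (hf.mono (hsub j (Finset.mem_range.2 hj))).pow 2
    simp only [Nat.cast_zero, mul_zero, zero_mul] at hsum
    rw [← hsum, Finset.mul_sum]
    refine Finset.sum_le_sum fun j hj => ?_
    rw [hend]
    exact integral_sq_secondDifference_le hr (hf.mono (hsub j hj))
  · intro j hj
    apply ContinuousOn.intervalIntegrable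
    rw [Set.uIcc_of_le hr.le]
    have hc : ∀ b ∈ Set.Icc 0 (2 * r), ContinuousOn (fun θ => f (3 * j * r + θ + b))
        (Set.Icc 0 r) := fun b hb => (hf.mono (hsub j hj)).comp (by fun_prop)
          fun θ hθ => ⟨by linarith [hθ.1, hb.1], by linarith [hθ.2, hb.2]⟩
    have h0 := hc 0 ⟨le_rfl, by linarith⟩
    simp only [add_zero] at h0
    have h1 := hc r ⟨hr.le, by linarith⟩
    have h2 := hc (2 * r) ⟨by linarith, le_rfl⟩
    exact ((h2.sub h1).sub (h1.sub h0)).pow 2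

section

variable {Ω : Type*} [MeasurableSpace Ω] {P : Measure Ω}

/-- Small ball estimate in `L²` for a Brownian bridge shifted by an affine function. -/
lemma IsRealBrownianBridge.measure_integral_sq_le {t : ℝ} {B : ℝ → Ω → ℝ}
    (hB : IsRealBrownianBridge t B P) (ht : 0 < t) {η : ℝ} (hη : 0 < η) (p q : ℝ) :
    P {ω | ∫ u in (0 : ℝ)..t, (p + q * u + B u ω) ^ 2 ≤ 2 * t * η ^ 2} ≤
      ENNReal.ofReal (Real.exp (1 - t / (2187 * η ^ 2))) := by
  have := hB.isGaussianProcess.isProbabilityMeasure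
  -- Since 2187 = 3 · 729, the step r = t/(3N) is at least 729η². Taking c = 1/(36η²) below then
  -- gives both 4cr ≥ 81 and c · 6 · 2tη²/r = N. The 1 in the exponent pays for the floor, and for N
  -- = 0 the bound is trivial.
  set N : ℕ := ⌊t / (2187 * η ^ 2)⌋₊ with hNdef
  have hN1 : t / (2187 * η ^ 2) < N + 1 := Nat.lt_floor_add_one _
  have hN2 : (N : ℝ) ≤ t / (2187 * η ^ 2) := Nat.floor_le (by positivity)
  have hfin : ENNReal.ofReal (Real.exp (-(N : ℝ))) ≤
      ENNReal.ofReal (Real.exp (1 - t / (2187 * η ^ 2))) :=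
    ENNReal.ofReal_le_ofReal (Real.exp_le_exp.2 (by linarith))
  refine le_trans ?_ hfin
  rcases Nat.eq_zero_or_pos N with h0 | hNpos
  · rw [h0]; simpa using prob_le_one
  have hNR : (0 : ℝ) < N := by exact_mod_cast hNpos
  set r : ℝ := t / (3 * N) with hrdef
  have hr : 0 < r := by positivity
  have hNr : 3 * N * r = t := by rw [hrdef]; field_simp
  have hrη : 729 * η ^ 2 ≤ r := by
    rw [le_div_iff₀ (by positivity)] at hN2
    rw [hrdef, le_div_iff₀ (by positivity)]
    linarith
  set c : ℝ := 1 / (36 * η ^ 2) with hcdef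
  have hc : 0 < c := by positivity
  have hcr : 81 ≤ 4 * c * r := by
    have : 4 * c * (729 * η ^ 2) ≤ 4 * c * r := by gcongr
    have h2 : 4 * c * (729 * η ^ 2) = 81 := by rw [hcdef]; field_simp; norm_num
    linarith
  have hmem : ∀ j ∈ Finset.range N, ∀ θ ∈ Set.Icc 0 r, ∀ b ∈ Set.Icc 0 (2 * r),
      3 * (j : ℝ) * r + θ + b ∈ Set.Icc 0 t := fun j hj θ hθ b hb => by
    have : (j : ℝ) + 1 ≤ N := by exact_mod_cast Finset.mem_range.1 hj
    have h3 : 3 * ((j : ℝ) + 1) * r ≤ t := by rw [← hNr]; gcongr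
    have h4 : 0 ≤ 3 * (j : ℝ) * r := by positivity
    exact ⟨by linarith [hθ.1, hb.1], by linarith [hθ.2, hb.2]⟩
  have hmem0 : ∀ j ∈ Finset.range N, ∀ θ ∈ Set.Icc 0 r, 3 * (j : ℝ) * r + θ ∈ Set.Icc 0 t :=
    fun j hj θ hθ => by simpa using hmem j hj θ hθ 0 ⟨le_rfl, by linarith⟩
  have hmem1 : ∀ j ∈ Finset.range N, ∀ θ ∈ Set.Icc 0 r, 3 * (j : ℝ) * r + θ + r ∈ Set.Icc 0 t :=
    fun j hj θ hθ => hmem j hj θ hθ r ⟨hr.le, by linarith⟩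
  have hmem2 : ∀ j ∈ Finset.range N, ∀ θ ∈ Set.Icc 0 r,
      3 * (j : ℝ) * r + θ + 2 * r ∈ Set.Icc 0 t :=
    fun j hj θ hθ => hmem j hj θ hθ (2 * r) ⟨by linarith, le_rfl⟩
  let S : ℝ → Ω → ℝ := fun θ ω => ∑ j ∈ Finset.range N, ((B (3 * j * r + θ + 2 * r) ω
      - B (3 * j * r + θ + r) ω) - (B (3 * j * r + θ + r) ω - B (3 * j * r + θ) ω)) ^ 2
  have hSm : ∀ θ ∈ Set.Icc 0 r, AEMeasurable (fun ω => -c * S θ ω) P := by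
    intro θ hθ
    refine AEMeasurable.const_mul (Finset.aemeasurable_fun_sum _ fun j hj => ?_) _
    have h0 := (hB.hasGaussianLaw (hmem0 j hj θ hθ)).aemeasurable
    have h1 := (hB.hasGaussianLaw (hmem1 j hj θ hθ)).aemeasurable
    have h2 := (hB.hasGaussianLaw (hmem2 j hj θ hθ)).aemeasurable
    exact ((h2.sub h1).sub (h1.sub h0)).pow_const 2
  have hSnn : ∀ θ ω, 0 ≤ S θ ω := fun θ ω => Finset.sum_nonneg fun _ _ => sq_nonneg _
  have key := measure_le_average_le (P := P) (g := fun θ ω => -c * S θ ω) hr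
    (C := ENNReal.ofReal ((1 / 9) ^ N)) ?_ hSm ?_ (-N)
  · rw [← ENNReal.ofReal_mul (Real.exp_pos _).le, neg_neg] at key
    have hle : Real.exp N * (1 / 9) ^ N ≤ Real.exp (-(N : ℝ)) := by
      have h1 : Real.exp N = Real.exp 1 ^ N := by rw [← Real.exp_nat_mul]; simp
      have h2 : Real.exp (-(N : ℝ)) = (Real.exp 1)⁻¹ ^ N := by
        rw [Real.exp_neg, h1, inv_pow]
      rw [h1, h2, ← mul_pow]
      gcongr
      rw [le_inv_comm₀ (by positivity) (Real.exp_pos _), mul_one_div, inv_div,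
        le_div_iff₀ (Real.exp_pos _)]
      nlinarith [Real.exp_one_lt_d9, Real.exp_pos 1]
    refine le_trans (measure_mono_ae ?_) (key.trans (ENNReal.ofReal_le_ofReal hle))
    filter_upwards [hB.continuousOn] with ω hω hmemω
    have hmemω : ∫ u in (0 : ℝ)..t, (p + q * u + B u ω) ^ 2 ≤ 2 * t * η ^ 2 := hmemω
    change -(N : ℝ) ≤ r⁻¹ * ∫ θ in (0 : ℝ)..r, -c * S θ ω
    have hcontf : ContinuousOn (fun u => p + q * u + B u ω) (Set.Icc 0 t) :=
      (by fun_prop : ContinuousOn (fun u => p + q * u) (Set.Icc 0 t)).add hω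
    have hint := integral_sum_sq_secondDifferences_le (f := fun u => p + q * u + B u ω) hr N
      (by rwa [hNr])
    rw [hNr] at hint
    -- The affine function p + qu has zero second differences.
    have hSeq : ∀ θ, S θ ω = ∑ j ∈ Finset.range N,
        (((p + q * (3 * j * r + θ + 2 * r) + B (3 * j * r + θ + 2 * r) ω)
          - (p + q * (3 * j * r + θ + r) + B (3 * j * r + θ + r) ω))
        - ((p + q * (3 * j * r + θ + r) + B (3 * j * r + θ + r) ω)
          - (p + q * (3 * j * r + θ) + B (3 * j * r + θ) ω))) ^ 2 := fun θ =>
      Finset.sum_congr rfl fun j _ => by ring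
    simp_rw [← hSeq] at hint
    rw [intervalIntegral.integral_const_mul]
    have hb : ∫ θ in (0 : ℝ)..r, S θ ω ≤ 6 * (2 * t * η ^ 2) := hint.trans (by gcongr)
    have hb2 : r⁻¹ * (c * ∫ θ in (0 : ℝ)..r, S θ ω) ≤ r⁻¹ * (c * (6 * (2 * t * η ^ 2))) := by
      gcongr
    have hb3 : r⁻¹ * (c * (6 * (2 * t * η ^ 2))) = N := by
      rw [hcdef, hrdef]; field_simp; norm_num
    linarith
  · filter_upwards [hB.continuousOn] with ω hω
    refine continuousOn_const.mul (continuousOn_finsetSum _ fun j hj => ?_)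
    have h0 : ContinuousOn (fun θ => B (3 * j * r + θ) ω) (Set.Icc 0 r) :=
      hω.comp (by fun_prop) (hmem0 j hj)
    have h1 : ContinuousOn (fun θ => B (3 * j * r + θ + r) ω) (Set.Icc 0 r) :=
      hω.comp (by fun_prop) (hmem1 j hj)
    have h2 : ContinuousOn (fun θ => B (3 * j * r + θ + 2 * r) ω) (Set.Icc 0 r) :=
      hω.comp (by fun_prop) (hmem2 j hj)
    exact ((h2.sub h1).sub (h1.sub h0)).pow 2
  · intro θ hθ
    rw [← ofReal_integral_eq_lintegral_ofReal]
    · exact ENNReal.ofReal_le_ofReal (hB.integral_exp_neg_sum_sq_secondDifferences_le hr hθ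
        hNr.le hc hcr)
    · refine Integrable.of_bound (hSm θ hθ).exp.aestronglyMeasurable 1
        (Filter.Eventually.of_forall fun ω => ?_)
      rw [Real.norm_eq_abs, abs_of_pos (Real.exp_pos _), Real.exp_le_one_iff]
      nlinarith [hSnn θ ω]
    · exact Filter.Eventually.of_forall fun _ => (Real.exp_pos _).le

end

/-! ### Pathwise comparison of power integrals, and time reversal. -/

/-- Jensen's inequality for powers, in contrapositive form. -/
lemma integral_le_of_integral_pow_le {φ : ℝ → ℝ} {s m : ℝ} {k : ℕ} (hs : 0 ≤ s) (hm : 0 < m)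
    (hk : 0 < k) (hφ : ContinuousOn φ (Set.Icc 0 s)) (hφ0 : ∀ u, 0 ≤ φ u)
    (h : ∫ u in (0 : ℝ)..s, φ u ^ k ≤ s * m ^ k) : ∫ u in (0 : ℝ)..s, φ u ≤ s * m := by
  rw [← Set.uIcc_of_le hs] at hφ
  have hi : IntervalIntegrable φ volume 0 s := hφ.intervalIntegrable
  have hik : IntervalIntegrable (fun u => φ u ^ k) volume 0 s := (hφ.pow k).intervalIntegrable
  have hk' : (0 : ℝ) < k := by exact_mod_cast hk
  -- By Bernoulli, y ↦ y^k lies above its tangent at y = m.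
  have hpt : ∀ u, m ^ k * (1 - k) + (k * m ^ k / m) * φ u ≤ φ u ^ k := by
    intro u
    have hb := one_add_mul_le_pow (a := φ u / m - 1)
      (by have : 0 ≤ φ u / m := div_nonneg (hφ0 u) hm.le
          linarith) k
    calc m ^ k * (1 - k) + (k * m ^ k / m) * φ u = m ^ k * (1 + k * (φ u / m - 1)) := by ring
      _ ≤ m ^ k * (1 + (φ u / m - 1)) ^ k := by gcongr
      _ = φ u ^ k := by
        rw [← mul_pow]; congr 1; field_simp; ring
  have hint := intervalIntegral.integral_mono_on hs
    ((intervalIntegrable_const (c := m ^ k * (1 - k))).add (hi.const_mul (k * m ^ k / m))) hik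
    fun u _ => hpt u
  rw [intervalIntegral.integral_add intervalIntegrable_const (hi.const_mul _),
    intervalIntegral.integral_const, intervalIntegral.integral_const_mul, smul_eq_mul,
    sub_zero] at hint
  have h3 : k * m ^ k / m * ∫ u in (0 : ℝ)..s, φ u ≤ k * m ^ k / m * (s * m) := by
    have : k * m ^ k / m * (s * m) = s * (k * m ^ k) := by field_simp
    rw [this]; linarith
  exact le_of_mul_le_mul_left h3 (by positivity)

/-- The pointwise bound y² ≤ η² + η^{2-k} y^k, checked separately for y ≤ η and y ≥ η, replaces
Hölder at the cost of a factor 2. -/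
lemma integral_sq_le_of_integral_pow_le {φ : ℝ → ℝ} {t η : ℝ} {k : ℕ} (ht : 0 ≤ t) (hη : 0 < η)
    (hk : 2 ≤ k) (hφ : ContinuousOn φ (Set.Icc 0 t)) (hφ0 : ∀ u, 0 ≤ φ u)
    (h : ∫ u in (0 : ℝ)..t, φ u ^ k ≤ t * η ^ k) :
    ∫ u in (0 : ℝ)..t, φ u ^ 2 ≤ 2 * t * η ^ 2 := by
  obtain ⟨m, rfl⟩ := Nat.exists_eq_add_of_le' hk
  rw [← Set.uIcc_of_le ht] at hφ
  have hik : IntervalIntegrable (fun u => φ u ^ (m + 2)) volume 0 t :=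
    (hφ.pow _).intervalIntegrable
  have hpt : ∀ u, φ u ^ 2 ≤ η ^ 2 + (η ^ m)⁻¹ * φ u ^ (m + 2) := by
    intro u
    have h0 := hφ0 u
    rcases le_total (φ u) η with h | h
    · have : φ u ^ 2 ≤ η ^ 2 := by gcongr
      have : 0 ≤ (η ^ m)⁻¹ * φ u ^ (m + 2) := by positivity
      linarith
    · have h1 : η ^ m ≤ φ u ^ m := by gcongr
      have h2 : φ u ^ 2 ≤ (η ^ m)⁻¹ * φ u ^ (m + 2) := by
        rw [le_inv_mul_iff₀ (by positivity), pow_add]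
        gcongr
      nlinarith [sq_nonneg η]
  calc ∫ u in (0 : ℝ)..t, φ u ^ 2
      ≤ ∫ u in (0 : ℝ)..t, (η ^ 2 + (η ^ m)⁻¹ * φ u ^ (m + 2)) :=
        intervalIntegral.integral_mono_on ht (hφ.pow 2).intervalIntegrable
          (intervalIntegrable_const.add (hik.const_mul _)) fun u _ => hpt u
    _ = t * η ^ 2 + (η ^ m)⁻¹ * ∫ u in (0 : ℝ)..t, φ u ^ (m + 2) := by
        rw [intervalIntegral.integral_add intervalIntegrable_const (hik.const_mul _),
          intervalIntegral.integral_const, intervalIntegral.integral_const_mul, smul_eq_mul,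
          sub_zero]
    _ ≤ t * η ^ 2 + (η ^ m)⁻¹ * (t * η ^ (m + 2)) := by gcongr
    _ = 2 * t * η ^ 2 := by rw [pow_add]; field_simp; ring

lemma bridgeFunctional_reverse {Ω : Type*} {n : ℕ} (k : ℕ) (t : ℝ) (x ξ : EuclideanSpace ℝ (Fin n))
    (W : ℝ → Ω → EuclideanSpace ℝ (Fin n)) (ω : Ω) :
    bridgeFunctional k t ξ x (fun s => W (t - s)) ω = bridgeFunctional k t x ξ W ω := by
  unfold bridgeFunctional
  have := intervalIntegral.integral_comp_sub_left (a := 0) (b := t)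
    (fun u => ‖((t - u) / t) • x + (u / t) • ξ + W u ω‖ ^ k) t
  rw [sub_self, sub_zero] at this
  rw [← this]
  congr 1 with u
  rw [sub_sub_cancel, add_comm ((u / t) • x)]

lemma continuousOn_bridge_path {n : ℕ} {t : ℝ} (x ξ : EuclideanSpace ℝ (Fin n))
    {w : ℝ → EuclideanSpace ℝ (Fin n)} (hw : ContinuousOn w (Set.Icc 0 t)) :
    ContinuousOn (fun u => ((t - u) / t) • x + (u / t) • ξ + w u) (Set.Icc 0 t) :=
  (by fun_prop : ContinuousOn (fun u : ℝ => ((t - u) / t) • x + (u / t) • ξ) (Set.Icc 0 t)).add hw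

/-! ### The two probability estimates for the functional. -/

section

variable {Ω : Type*} [MeasurableSpace Ω] {P : Measure Ω} {n : ℕ}

/-- If the larger endpoint is far from the origin, then a small value of the functional forces a
large deviation of the bridge near that endpoint. -/
lemma IsStandardBrownianBridge.measure_bridgeFunctional_le_of_norm_le {k : ℕ} (hk : 0 < k) {t : ℝ}
    (ht : 0 < t) {W : ℝ → Ω → EuclideanSpace ℝ (Fin n)} (hW : IsStandardBrownianBridge t W P)
    {x ξ : EuclideanSpace ℝ (Fin n)} (hx : x ≠ 0) (hξx : ‖ξ‖ ≤ ‖x‖) {D : ℝ} (hD : 0 < D)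
    (hDt : 2 ^ (k + 2) * D ≤ t * ‖x‖ ^ k) :
    P {ω | bridgeFunctional k t x ξ W ω ≤ D} ≤
      ENNReal.ofReal (Real.exp (-(‖x‖ ^ (2 + k) / (32 * 2 ^ k * D)))) := by
  have hρ : 0 < ‖x‖ := norm_pos_iff.2 hx
  set e : EuclideanSpace ℝ (Fin n) := ‖x‖⁻¹ • x with he
  have hne : ‖e‖ = 1 := by rw [he, norm_smul, norm_inv, norm_norm, inv_mul_cancel₀ hρ.ne']
  set s : ℝ := 2 ^ k * D / ‖x‖ ^ k with hsdef
  have hs : 0 < s := by positivity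
  have hst : 4 * s ≤ t := by
    rw [hsdef, ← mul_div_assoc, div_le_iff₀ (by positivity)]
    calc 4 * (2 ^ k * D) = 2 ^ (k + 2) * D := by ring
      _ ≤ _ := hDt
  have hst' : s ≤ t := by linarith
  have key := (hW.inner_left hne).measure_average_le hs hst' (d := ‖x‖ / 4) (by positivity)
  have hexp : (‖x‖ / 4) ^ 2 / (2 * s) = ‖x‖ ^ (2 + k) / (32 * 2 ^ k * D) := by
    rw [hsdef, pow_add]; field_simp; norm_num
  rw [hexp] at key
  refine le_trans (measure_mono_ae ?_) key
  filter_upwards [hW.continuousOn] with ω hω hωD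
  have hωD : ∫ u in (0 : ℝ)..t, ‖((t - u) / t) • x + (u / t) • ξ + W u ω‖ ^ k ≤ D := hωD
  change s⁻¹ * ∫ u in (0 : ℝ)..s, inner ℝ e (W u ω) ≤ -(‖x‖ / 4)
  have hsub : Set.Icc 0 s ⊆ Set.Icc 0 t := Set.Icc_subset_Icc_right hst'
  have hZ := continuousOn_bridge_path x ξ hω
  have hZn := hZ.norm
  have h1 : ∫ u in (0 : ℝ)..s, ‖((t - u) / t) • x + (u / t) • ξ + W u ω‖ ^ k
      ≤ s * (‖x‖ / 2) ^ k := by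
    have hsD : s * (‖x‖ / 2) ^ k = D := by rw [hsdef, div_pow]; field_simp
    rw [hsD]
    refine le_trans (intervalIntegral.integral_mono_interval le_rfl hs.le hst' ?_ ?_) hωD
    · exact Filter.Eventually.of_forall fun u => by positivity
    · apply ContinuousOn.intervalIntegrable
      rw [Set.uIcc_of_le ht.le]
      exact hZn.pow k
  have h2 := integral_le_of_integral_pow_le hs.le (by positivity) hk (hZn.mono hsub)
    (fun u => norm_nonneg _) h1
  have hWint : IntervalIntegrable (fun u => inner ℝ e (W u ω)) volume 0 s := by
    apply ContinuousOn.intervalIntegrable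
    rw [Set.uIcc_of_le hs.le]
    exact continuousOn_const.inner (hω.mono hsub)
  have hlin : IntervalIntegrable (fun u : ℝ => ‖x‖ - 2 * ‖x‖ / t * u) volume 0 s :=
    Continuous.intervalIntegrable (by fun_prop) _ _
  -- In the worst case ξ = -x, the projected drift falls linearly from ‖x‖ to -‖x‖.
  have hpt : ∀ u ∈ Set.Icc 0 s, (‖x‖ - 2 * ‖x‖ / t * u) + inner ℝ e (W u ω) ≤
      ‖((t - u) / t) • x + (u / t) • ξ + W u ω‖ := by
    intro u hu
    have hex : inner ℝ e x = ‖x‖ := by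
      rw [he, real_inner_smul_left, real_inner_self_eq_norm_sq]; field_simp
    have heξ : -‖x‖ ≤ inner ℝ e ξ := by
      have := abs_real_inner_le_norm e ξ
      rw [hne, one_mul] at this
      linarith [neg_abs_le (inner ℝ e ξ : ℝ)]
    have hle := real_inner_le_norm e (((t - u) / t) • x + (u / t) • ξ + W u ω)
    rw [hne, one_mul, inner_add_right, inner_add_right, real_inner_smul_right,
      real_inner_smul_right, hex] at hle
    have hut : 0 ≤ u / t := div_nonneg hu.1 ht.le
    have h4 : u / t * (-‖x‖) ≤ u / t * inner ℝ e ξ := by gcongr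
    have h5 : (t - u) / t * ‖x‖ + u / t * (-‖x‖) = ‖x‖ - 2 * ‖x‖ / t * u := by field_simp; ring
    linarith
  have h3 := intervalIntegral.integral_mono_on hs.le (hlin.add hWint) (by
    apply ContinuousOn.intervalIntegrable
    rw [Set.uIcc_of_le hs.le]
    exact hZn.mono hsub) hpt
  have hlin_eq : ∫ u in (0 : ℝ)..s, (‖x‖ - 2 * ‖x‖ / t * u) = ‖x‖ * s - ‖x‖ / t * s ^ 2 := by
    rw [intervalIntegral.integral_sub (by simp) (Continuous.intervalIntegrable (by fun_prop) _ _),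
      intervalIntegral.integral_const, intervalIntegral.integral_const_mul, integral_id]
    simp only [smul_eq_mul]; ring
  rw [intervalIntegral.integral_add hlin hWint, hlin_eq] at h3
  have h6 : ‖x‖ / t * s ^ 2 ≤ ‖x‖ * s / 4 := by
    rw [div_mul_eq_mul_div, div_le_iff₀ ht]
    have : ‖x‖ * s * (4 * s) ≤ ‖x‖ * s * t := by gcongr
    linarith
  rw [inv_mul_le_iff₀ hs]
  linarith

lemma IsStandardBrownianBridge.measure_bridgeFunctional_le {k : ℕ} (hk : 0 < k) {t : ℝ}
    (ht : 0 < t) {W : ℝ → Ω → EuclideanSpace ℝ (Fin n)} (hW : IsStandardBrownianBridge t W P)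
    {x ξ : EuclideanSpace ℝ (Fin n)} (hx : x ≠ 0) (hξ : ξ ≠ 0) {D : ℝ} (hD : 0 < D)
    (hDt : 2 ^ (k + 3) * (D / (‖x‖ ^ k + ‖ξ‖ ^ k)) ≤ t) :
    P {ω | bridgeFunctional k t x ξ W ω ≤ D} ≤ ENNReal.ofReal
      (Real.exp (-(64 * 2 ^ k)⁻¹ * ((‖x‖ ^ (2 + k) + ‖ξ‖ ^ (2 + k)) / D))) := by
  wlog hξx : ‖ξ‖ ≤ ‖x‖ generalizing x ξ W
  · have h := this (hW.reverse ht) hξ hx (by rwa [add_comm (‖ξ‖ ^ k)]) (le_of_not_ge hξx)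
    simp_rw [bridgeFunctional_reverse k t x ξ W] at h
    rwa [add_comm (‖ξ‖ ^ (2 + k))] at h
  have hρ : 0 < ‖x‖ := norm_pos_iff.2 hx
  have hk1 : ‖ξ‖ ^ k ≤ ‖x‖ ^ k := by gcongr
  have hk2 : ‖ξ‖ ^ (2 + k) ≤ ‖x‖ ^ (2 + k) := by gcongr
  refine (hW.measure_bridgeFunctional_le_of_norm_le hk ht hx hξx hD ?_).trans
    (ENNReal.ofReal_le_ofReal (Real.exp_le_exp.2 ?_))
  -- Bounding both endpoint terms by that of x costs a factor 2, both here and in the exponent (32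
  -- becomes 64).
  · rw [← mul_div_assoc, div_le_iff₀ (by positivity), pow_succ] at hDt
    have : t * (‖x‖ ^ k + ‖ξ‖ ^ k) ≤ t * (‖x‖ ^ k + ‖x‖ ^ k) := by gcongr
    linarith
  · rw [neg_mul, neg_le_neg_iff]
    calc (64 * 2 ^ k)⁻¹ * ((‖x‖ ^ (2 + k) + ‖ξ‖ ^ (2 + k)) / D)
        ≤ (64 * 2 ^ k)⁻¹ * ((‖x‖ ^ (2 + k) + ‖x‖ ^ (2 + k)) / D) := by gcongr
      _ = ‖x‖ ^ (2 + k) / (32 * 2 ^ k * D) := by field_simp; ring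

/-- Small ball estimate for the functional, uniform in the endpoints. -/
lemma IsStandardBrownianBridge.measure_bridgeFunctional_le_of_small {k : ℕ} (hk : 2 ≤ k)
    (hn : 1 ≤ n) {t : ℝ} (ht : 0 < t) {W : ℝ → Ω → EuclideanSpace ℝ (Fin n)}
    (hW : IsStandardBrownianBridge t W P) (x ξ : EuclideanSpace ℝ (Fin n)) {D : ℝ} (hD : 0 < D) :
    P {ω | bridgeFunctional k t x ξ W ω ≤ D} ≤ ENNReal.ofReal
      (Real.exp (1 - 2187⁻¹ * (t ^ (1 + 2 / (k : ℝ)) / D ^ (2 / (k : ℝ))))) := by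
  have hk0 : (k : ℝ) ≠ 0 := by positivity
  -- η is the size at which a constant |Z| would give Y_t = D.
  set η : ℝ := (D / t) ^ (1 / (k : ℝ)) with hηdef
  have hη : 0 < η := by positivity
  have hηk : t * η ^ k = D := by
    rw [hηdef, ← Real.rpow_mul_natCast (by positivity), one_div_mul_cancel hk0, Real.rpow_one]
    field_simp
  have hη2 : t / (2187 * η ^ 2) = 2187⁻¹ * (t ^ (1 + 2 / (k : ℝ)) / D ^ (2 / (k : ℝ))) := by
    have : η ^ 2 = D ^ (2 / (k : ℝ)) / t ^ (2 / (k : ℝ)) := by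
      rw [hηdef, ← Real.rpow_mul_natCast (by positivity), ← Real.div_rpow hD.le ht.le]
      congr 1; push_cast; ring
    rw [this, Real.rpow_add ht, Real.rpow_one]
    field_simp
  let e : EuclideanSpace ℝ (Fin n) := EuclideanSpace.single ⟨0, hn⟩ 1
  have hne : ‖e‖ = 1 := by simp [e]
  have key := (hW.inner_left hne).measure_integral_sq_le ht hη (inner ℝ e x)
    (t⁻¹ * (inner ℝ e ξ - inner ℝ e x))
  rw [hη2] at key
  refine le_trans (measure_mono_ae ?_) key
  filter_upwards [hW.continuousOn] with ω hω hωD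
  have hωD : ∫ u in (0 : ℝ)..t, ‖((t - u) / t) • x + (u / t) • ξ + W u ω‖ ^ k ≤ D := hωD
  change ∫ u in (0 : ℝ)..t, (inner ℝ e x + t⁻¹ * (inner ℝ e ξ - inner ℝ e x) * u
    + inner ℝ e (W u ω)) ^ 2 ≤ 2 * t * η ^ 2
  have hZ := continuousOn_bridge_path x ξ hω
  rw [← hηk] at hωD
  refine le_trans ?_ (integral_sq_le_of_integral_pow_le ht.le hη hk hZ.norm
    (fun _ => norm_nonneg _) hωD)
  have heq : ∀ u, inner ℝ e x + t⁻¹ * (inner ℝ e ξ - inner ℝ e x) * u + inner ℝ e (W u ω)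
      = inner ℝ e (((t - u) / t) • x + (u / t) • ξ + W u ω) := fun u => by
    rw [inner_add_right, inner_add_right, real_inner_smul_right, real_inner_smul_right]
    field_simp; ring
  simp_rw [heq]
  refine intervalIntegral.integral_mono_on ht.le ?_ ?_ fun u _ => ?_
  · apply ContinuousOn.intervalIntegrable
    rw [Set.uIcc_of_le ht.le]
    exact (continuousOn_const.inner hZ).pow 2
  · apply ContinuousOn.intervalIntegrable
    rw [Set.uIcc_of_le ht.le]
    exact hZ.norm.pow 2
  · refine sq_le_sq' ?_ ?_
    · have := abs_real_inner_le_norm e (((t - u) / t) • x + (u / t) • ξ + W u ω)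
      rw [hne, one_mul] at this
      exact (abs_le.1 this).1
    · have := real_inner_le_norm e (((t - u) / t) • x + (u / t) • ξ + W u ω)
      rwa [hne, one_mul] at this

end

theorem mainTheorem11 (n k : ℕ) (hn : 1 ≤ n) (hk : 0 < k) (hk_even : Even k) :
    (∃ c₁ c₂ : ℝ, 0 < c₁ ∧ 0 < c₂ ∧
      ∀ (Ω : Type v) [MeasurableSpace Ω] (P : Measure Ω) [IsProbabilityMeasure P]
        (t : ℝ) (W : ℝ → Ω → EuclideanSpace ℝ (Fin n))
        (x ξ : EuclideanSpace ℝ (Fin n)) (xlast ξlast : ℝ),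
        0 < t → IsStandardBrownianBridge t W P →
        x ≠ 0 → ξ ≠ 0 → xlast < ξlast →
        2 ^ (k + 3) * ((ξlast - xlast) / (‖x‖ ^ k + ‖ξ‖ ^ k)) ≤ t →
        P.real {ω | bridgeFunctional k t x ξ W ω ≤ ξlast - xlast} ≤
          c₁ * Real.exp (-c₂ * ((‖x‖ ^ (2 + k) + ‖ξ‖ ^ (2 + k)) / (ξlast - xlast)))) ∧
    (∀ K : ℝ, 0 ≤ K → ∃ c₁ c₂ : ℝ, 0 < c₁ ∧ 0 < c₂ ∧
      ∀ (Ω : Type v) [MeasurableSpace Ω] (P : Measure Ω) [IsProbabilityMeasure P]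
        (t : ℝ) (W : ℝ → Ω → EuclideanSpace ℝ (Fin n))
        (x ξ : EuclideanSpace ℝ (Fin n)) (xlast ξlast : ℝ),
        0 < t → IsStandardBrownianBridge t W P →
        xlast < ξlast →
        ((ξlast - xlast) * (3 / 4) * (64 * K) ^ k) ^ (2 / ((k : ℝ) + 2)) ≤ t →
        max ‖x‖ ‖ξ‖ ≤ K * √t →
        P.real {ω | bridgeFunctional k t x ξ W ω ≤ ξlast - xlast} ≤
          c₁ * Real.exp (-c₂ * (t ^ (1 + 2 / (k : ℝ)) /
            (ξlast - xlast) ^ (2 / (k : ℝ))))) := by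
  constructor
  · refine ⟨1, (64 * 2 ^ k)⁻¹, one_pos, by positivity, ?_⟩
    intro Ω _ P _ t W x ξ xlast ξlast ht hW hx hξ hlast hDt
    rw [one_mul]
    exact ENNReal.toReal_le_of_le_ofReal (Real.exp_pos _).le
      (hW.measure_bridgeFunctional_le hk ht hx hξ (sub_pos.2 hlast) hDt)
  · intro K _
    -- The factor e comes from rounding down the number of blocks.
    refine ⟨Real.exp 1, 2187⁻¹, Real.exp_pos _, by norm_num, ?_⟩
    intro Ω _ P _ t W x ξ xlast ξlast ht hW hlast _ _
    have hk2 : 2 ≤ k := by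
      obtain ⟨m, rfl⟩ := hk_even
      lia
    rw [← Real.exp_add, neg_mul, ← sub_eq_add_neg]
    exact ENNReal.toReal_le_of_le_ofReal (Real.exp_pos _).le
      (hW.measure_bridgeFunctional_le_of_small hk2 hn ht x ξ (sub_pos.2 hlast))
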